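/- Let $\mathscr{H}$ be a complex Hilbert space and let $\mathscr{A}$ be a $C^*$-algebra with $\mathbb{K}(\mathscr{H})\subseteq\mathscr{A}\subseteq\mathbb{B}(\mathscr{H})$, that is, a norm-closed, self-adjoint (not necessarily unital) subalgebra of the algebra $\mathbb{B}(\mathscr{H})$ of bounded operators which contains all compact operators. An inner product $\mathscr{A}$-module is a complex linear space $\mathscr{E}$ which is a right $\mathscr{A}$-module with $\mu(xa)=(\mu x)a=x(\mu a)$, equipped with a map $\langle\cdot,\cdot\rangle:\mathscr{E}\times\mathscr{E}\to\mathscr{A}$ such that $\langle x,\alpha y+\beta z\rangle=\alpha\langle x,y\rangle+\beta\langle x,z\rangle$, $\langle x,ya\rangle=\langle x,y\rangle a$, $\langle x,y\rangle^*=\langle y,x\rangle$, $\langle x,x\rangle\ge 0$, and $\langle x,x\rangle=0$ if and only if $x=0$, for all $x,y,z\in\mathscr{E}$, $a\in\mathscr{A}$, $\alpha,\beta,\mu\in\mathbb{C}$ (no completeness is assumed). Write $|x|=\langle x,x\rangle^{1/2}\in\mathscr{A}$ for the positive square root. Let $\mathscr{E}$ and $\mathscr{F}$ be inner product $\mathscr{A}$-modules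 and let $T:\mathscr{E}\to\mathscr{F}$ be a nonzero $\mathscr{A}$-linear map, i.e. $T$ is $\mathbb{C}$-linear and $T(xa)=(Tx)a$ for all $x\in\mathscr{E}$, $a\in\mathscr{A}$ (no boundedness is assumed). Then the following are equivalent: (a) $T$ is orthogonality preserving: for all $x,y\in\mathscr{E}$, $\langle x,y\rangle=0$ implies $\langle Tx,Ty\rangle=0$; (b) for all $x,y\in\mathscr{E}$, $|x|\le|y|$ implies $|Tx|\le|Ty|$. -/

import Mathlib

open scoped RightActions

/-- The order that a norm-closed `*`-subalgebra `A` of `𝔹(H)` inherits from `𝔹(H)` (the Loewner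
order) is the order of the C⋆-algebra `A`: an element of `A` is nonnegative if and only if it is
of the form `b⋆ b` with `b ∈ A`. -/
instance operatorAlgebra_starOrderedRing {H : Type*} [NormedAddCommGroup H]
    [InnerProductSpace ℂ H] [CompleteSpace H] (A : NonUnitalStarSubalgebra ℂ (H →L[ℂ] H))
    [hA : IsClosed (A : Set (H →L[ℂ] H))] : StarOrderedRing A := by
  refine StarOrderedRing.of_le_iff fun x y => ⟨fun hxy => ?_, ?_⟩
  · have h0 : (0 : H →L[ℂ] H) ≤ ((y - x : A) : H →L[ℂ] H) := by
      simpa using (sub_nonneg.2 (show (x : H →L[ℂ] H) ≤ y from hxy))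
    have hmem : CFC.sqrt ((y - x : A) : H →L[ℂ] H) ∈ A := by
      rw [CFC.sqrt_eq_real_sqrt _ h0]
      exact cfcₙ_mem (𝕜' := ℂ) (hs := hA) _ (y - x).2
    refine ⟨⟨_, hmem⟩, ?_⟩
    apply Subtype.ext
    have h1 := CFC.sqrt_mul_sqrt_self _ h0
    have h2 : star (CFC.sqrt ((y - x : A) : H →L[ℂ] H)) = CFC.sqrt ((y - x : A) : H →L[ℂ] H) :=
      (IsSelfAdjoint.of_nonneg (CFC.sqrt_nonneg _)).star_eq
    change (y : H →L[ℂ] H) = x + star (CFC.sqrt ((y - x : A) : H →L[ℂ] H)) *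
      CFC.sqrt ((y - x : A) : H →L[ℂ] H)
    rw [h2, h1]
    simp
  · rintro ⟨s, rfl⟩
    change (x : H →L[ℂ] H) ≤ x + star (s : H →L[ℂ] H) * s
    exact le_add_of_nonneg_right (star_mul_self_nonneg (s : H →L[ℂ] H))

/-- `InnerProductCStarModule A E`: the complex linear space `E`, with a right action
`x <• a` of the C⋆-algebra `A`, is an inner product `A`-module. No completeness is required. -/
class InnerProductCStarModule (A E : Type*) [NonUnitalCStarAlgebra A] [PartialOrder A]
    [AddCommGroup E] [Module ℂ E] [SMul Aᵐᵒᵖ E] extends Inner A E where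
  add_rsmul (x y : E) (a : A) : (x + y) <• a = x <• a + y <• a
  rsmul_add (x : E) (a b : A) : x <• (a + b) = x <• a + x <• b
  rsmul_rsmul (x : E) (a b : A) : (x <• a) <• b = x <• (a * b)
  smul_rsmul (μ : ℂ) (x : E) (a : A) : μ • (x <• a) = (μ • x) <• a
  rsmul_smul (μ : ℂ) (x : E) (a : A) : x <• (μ • a) = μ • (x <• a)
  inner_add_right (x y z : E) : inner x (y + z) = inner x y + inner x z
  inner_smul_right (μ : ℂ) (x y : E) : inner x (μ • y) = μ • inner x y
  inner_rsmul_right (x y : E) (a : A) : inner x (y <• a) = inner x y * a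
  star_inner (x y : E) : star (inner x y) = inner y x
  inner_self_nonneg (x : E) : 0 ≤ inner x x
  inner_self_eq_zero (x : E) : inner x x = 0 ↔ x = 0

namespace InnerProductCStarModule

variable (A : Type*) {E F : Type*} [NonUnitalCStarAlgebra A] [PartialOrder A] [StarOrderedRing A]
  [AddCommGroup E] [Module ℂ E] [SMul Aᵐᵒᵖ E] [InnerProductCStarModule A E]
  [AddCommGroup F] [Module ℂ F] [SMul Aᵐᵒᵖ F] [InnerProductCStarModule A F]

/-- The modulus `|x|`: the positive square root of `⟨x, x⟩` in `A`. -/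
noncomputable def modulus (x : E) : A := CFC.sqrt (inner A x x)

/-- A complex linear map `T : E → F` is `A`-linear if `T (x a) = (T x) a`. -/
def IsModuleLinear (T : E →ₗ[ℂ] F) : Prop :=
  ∀ (x : E) (a : A), T (x <• a) = T x <• a

/-- `T` is orthogonality preserving if `⟨x, y⟩ = 0` implies `⟨T x, T y⟩ = 0`. -/
def IsOrthogonalityPreserving (T : E →ₗ[ℂ] F) : Prop :=
  ∀ x y : E, inner A x y = 0 → inner A (T x) (T y) = 0

end InnerProductCStarModule

/-! Orthogonality preservation forces `⟨Tx, Tx⟩ = c² ⟨x, x⟩` with a single `c ≥ 0`, so `|Tx| = c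
|x|` and moduli stay ordered. Rank-one operators lie in `A` and reduce this to scalars: for `S`
sending `ζ` to a multiple of `ξ` and killing `ζ⊥`, `⟨uS, vS⟩` is `(ξ, ⟨u, v⟩ ξ)` times a fixed
rank-one operator. Hence `T` preserves orthogonality for every form `vectorForm A ζ`, and
`hermitianForm_proportional` applies; moving `ξ` to `η` by a rank-one operator makes the ratio
independent of the vector. Conversely, `x ⊥ y` gives `|x + y| = |x - y|`, and expanding the images
shows `⟨Tx, Ty⟩ = 0`. -/

namespace InnerProductCStarModule

section Algebra

open scoped ComplexConjugate

variable {A E : Type*} [NonUnitalCStarAlgebra A] [PartialOrder A]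
  [AddCommGroup E] [Module ℂ E] [SMul Aᵐᵒᵖ E] [InnerProductCStarModule A E]

theorem inner_add_left (x y z : E) : inner A (x + y) z = inner A x z + inner A y z := by
  rw [← star_inner z, inner_add_right, star_add, star_inner, star_inner]

theorem inner_smul_left (μ : ℂ) (x y : E) : inner A (μ • x) y = conj μ • inner A x y := by
  rw [← star_inner y, inner_smul_right, star_smul, star_inner]
  rfl

theorem inner_rsmul_left (x y : E) (a : A) : inner A (x <• a) y = star a * inner A x y := by
  rw [← star_inner y, inner_rsmul_right, star_mul, star_inner]

theorem inner_neg_right (x y : E) : inner A x (-y) = -inner A x y := by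
  simpa using inner_smul_right (A := A) (-1) x y

theorem inner_neg_left (x y : E) : inner A (-x) y = -inner A x y := by
  simpa using inner_smul_left (A := A) (-1) x y

theorem inner_add_self (x y : E) :
    inner A (x + y) (x + y) = inner A x x + inner A y y + (inner A x y + inner A y x) := by
  rw [inner_add_left, inner_add_right, inner_add_right]
  abel

theorem inner_add_neg_self (x y : E) :
    inner A (x + -y) (x + -y) = inner A x x + inner A y y - (inner A x y + inner A y x) := by
  rw [inner_add_self, inner_neg_right, inner_neg_left, inner_neg_right, inner_neg_left]
  abel

end Algebra

section Modulus

open scoped ComplexConjugate ComplexOrder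

variable {A E F : Type*} [NonUnitalCStarAlgebra A] [PartialOrder A] [StarOrderedRing A]
  [AddCommGroup E] [Module ℂ E] [SMul Aᵐᵒᵖ E] [InnerProductCStarModule A E]
  [AddCommGroup F] [Module ℂ F] [SMul Aᵐᵒᵖ F] [InnerProductCStarModule A F]

theorem modulus_mul_modulus (x : E) : modulus A x * modulus A x = inner A x x :=
  CFC.sqrt_mul_sqrt_self _ (inner_self_nonneg x)

/-- If `T` is monotone with respect to moduli and `⟨x, y⟩ = 0`, then the real part of
`⟨T x, T y⟩` vanishes: `x + y` and `x - y` have the same modulus, hence so do their images. -/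
theorem inner_map_add_inner_map_eq_zero {T : E →ₗ[ℂ] F}
    (h : ∀ x y : E, modulus A x ≤ modulus A y → modulus A (T x) ≤ modulus A (T y))
    {x y : E} (hxy : inner A x y = 0) :
    inner A (T x) (T y) + inner A (T y) (T x) = 0 := by
  have hyx : inner A y x = 0 := by rw [← star_inner x y, hxy, star_zero]
  have hmod : modulus A (x + y) = modulus A (x + -y) := by
    rw [modulus, modulus, inner_add_self, inner_add_neg_self, hxy, hyx]
    simp
  have hT : modulus A (T (x + y)) = modulus A (T (x + -y)) :=
    le_antisymm (h _ _ hmod.le) (h _ _ hmod.ge)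
  have hinner : inner A (T (x + y)) (T (x + y)) = inner A (T (x + -y)) (T (x + -y)) := by
    rw [← modulus_mul_modulus, ← modulus_mul_modulus, hT]
  rw [map_add, map_add, map_neg, inner_add_self, inner_add_neg_self, sub_eq_add_neg,
    add_right_inj] at hinner
  have := IsAddTorsionFree.of_isTorsionFree ℂ A
  exact self_eq_neg.1 hinner

theorem isOrthogonalityPreserving_of_modulus_monotone {T : E →ₗ[ℂ] F}
    (h : ∀ x y : E, modulus A x ≤ modulus A y → modulus A (T x) ≤ modulus A (T y)) :
    IsOrthogonalityPreserving A T := by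
  intro x y hxy
  have h1 := inner_map_add_inner_map_eq_zero h hxy
  -- Passing from `y` to `i y` kills the imaginary part.
  have h2 := inner_map_add_inner_map_eq_zero h (x := x) (y := Complex.I • y)
    (by rw [inner_smul_right, hxy, smul_zero])
  rw [map_smul, inner_smul_right, inner_smul_left, Complex.conj_I, neg_smul, ← sub_eq_add_neg,
    ← smul_sub, smul_eq_zero_iff_right Complex.I_ne_zero, sub_eq_zero] at h2
  rw [← h2] at h1
  have := IsAddTorsionFree.of_isTorsionFree ℂ A
  exact self_eq_neg.1 (eq_neg_of_add_eq_zero_left h1)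

theorem modulus_eq_smul {x : E} {y : F} {c : ℂ} (hc : 0 ≤ c)
    (h : inner A y y = (c * c) • inner A x x) :
    modulus A y = c • modulus A x := by
  refine CFC.sqrt_unique ?_ (smul_nonneg hc (CFC.sqrt_nonneg _))
  rw [smul_mul_smul_comm, h]
  exact congrArg _ (modulus_mul_modulus x)

theorem modulus_map_le_modulus_map {T : E →ₗ[ℂ] F} {c : ℂ} (hc : 0 ≤ c)
    (h : ∀ x : E, inner A (T x) (T x) = (c * c) • inner A x x) {x y : E}
    (hxy : modulus A x ≤ modulus A y) : modulus A (T x) ≤ modulus A (T y) := by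
  rw [modulus_eq_smul hc (h x), modulus_eq_smul hc (h y)]
  exact smul_le_smul_of_nonneg_left hxy hc

end Modulus

end InnerProductCStarModule

open scoped ComplexConjugate in
/-- If `C u v = 0` whenever `B u v = 0`, for Hermitian forms `B` and `C`, then the quadratic forms
of `B` and `C` are proportional. -/
theorem hermitianForm_proportional {V : Type*} [AddCommGroup V] [Module ℂ V]
    {B C : V → V →ₗ[ℂ] ℂ} (hB : ∀ u v, conj (B u v) = B v u) (hC : ∀ u v, conj (C u v) = C v u)
    (h : ∀ u v, B u v = 0 → C u v = 0) (u v : V) :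
    C u u * B v v = B u u * C v v := by
  have left (u v : V) : C u v * B u u = B u v * C u u := by
    -- Gram–Schmidt with denominators cleared, so `B u u = 0` is allowed.
    have := h u (B u u • v - B u v • u) (by simp [mul_comm])
    simp only [map_sub, map_smul, smul_eq_mul] at this
    linear_combination this
  have right (u v : V) : C u v * B v v = B u v * C v v := by
    simpa only [map_mul, hB, hC] using congrArg conj (left v u)
  by_cases huv : B u v = 0
  · have hvu : B v u = 0 := by rw [← hB, huv, map_zero]
    have hadd {D : V → V →ₗ[ℂ] ℂ} (hD : ∀ u v, conj (D u v) = D v u) (a b c : V) :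
        D (a + b) c = D a c + D b c := by
      rw [← hD, map_add, map_add, hD, hD]
    -- For orthogonal `u`, `v` the relation `right` is trivial; `u + v` links both quadratic forms.
    have := right u (u + v)
    simp only [hadd hB, hadd hC, map_add, huv, hvu, h _ _ huv, h _ _ hvu] at this
    linear_combination this
  · refine mul_left_cancel₀ huv ?_
    linear_combination B u u * right u v - B v v * left u v

section OperatorAlgebra

open InnerProductCStarModule InnerProductSpace

open scoped ComplexConjugate ComplexOrder

variable {H : Type*} [NormedAddCommGroup H] [InnerProductSpace ℂ H] [CompleteSpace H]

omit [CompleteSpace H] in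
theorem isCompactOperator_rankOne (ξ η : H) : IsCompactOperator (rankOne ℂ ξ η) := by
  have hid : IsCompactOperator (id : ℂ → ℂ) :=
    ⟨Metric.closedBall 0 1, isCompact_closedBall _ _, Metric.closedBall_mem_nhds _ one_pos⟩
  exact (hid.comp_clm (innerSL ℂ η)).clm_comp (ContinuousLinearMap.toSpanSingleton ℂ ξ)

variable {A : NonUnitalStarSubalgebra ℂ (H →L[ℂ] H)} [hA : IsClosed (A : Set (H →L[ℂ] H))]
  {E F : Type*} [AddCommGroup E] [Module ℂ E] [SMul (↥A)ᵐᵒᵖ E] [InnerProductCStarModule A E]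
  [AddCommGroup F] [Module ℂ F] [SMul (↥A)ᵐᵒᵖ F] [InnerProductCStarModule A F]

variable (A) in
/-- The scalar form `(ζ, ⟨u, v⟩ ζ)` of an inner product module over an algebra of operators. -/
noncomputable def vectorForm (ζ : H) (u : E) : E →ₗ[ℂ] ℂ where
  toFun v := inner ℂ ζ (((inner A u v : A) : H →L[ℂ] H) ζ)
  map_add' v w := by simp [InnerProductCStarModule.inner_add_right]
  map_smul' c v := by simp [InnerProductCStarModule.inner_smul_right]

theorem vectorForm_apply (ζ : H) (u v : E) :
    vectorForm A ζ u v = inner ℂ ζ (((inner A u v : A) : H →L[ℂ] H) ζ) := rfl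

theorem conj_vectorForm (ζ : H) (u v : E) :
    conj (vectorForm A ζ u v) = vectorForm A ζ v u := by
  rw [vectorForm_apply, vectorForm_apply, inner_conj_symm, ← star_inner u v,
    StarMemClass.coe_star, ContinuousLinearMap.star_eq_adjoint,
    ContinuousLinearMap.adjoint_inner_right]

theorem vectorForm_self_nonneg (ζ : H) (u : E) : 0 ≤ vectorForm A ζ u u :=
  ((ContinuousLinearMap.nonneg_iff_isPositive _).1
    (inner_self_nonneg (A := A) u)).inner_nonneg_right ζ

/-- The inner products of the vectors `u S` and `v S`, where `S` has rank one. -/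
theorem inner_rsmul_rankOne {ξ ζ : H} (S : A) (hS : (S : H →L[ℂ] H) = rankOne ℂ ξ ζ) (u v : E) :
    ((inner A (u <• S) (v <• S) : A) : H →L[ℂ] H) = vectorForm A ξ u v • rankOne ℂ ζ ζ := by
  rw [inner_rsmul_right, inner_rsmul_left]
  ext η
  simp [hS, vectorForm_apply, ContinuousLinearMap.star_eq_adjoint, smul_smul, mul_comm]

/-- Carries the form at `ξ` over to the form at `ζ`, so that different vectors can be compared. -/
theorem vectorForm_rsmul_rankOne {ξ ζ : H} (S : A) (hS : (S : H →L[ℂ] H) = rankOne ℂ ξ ζ)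
    (u v : E) : vectorForm A ζ (u <• S) (v <• S) =
      vectorForm A ξ u v * inner ℂ ζ (rankOne ℂ ζ ζ ζ) := by
  rw [vectorForm_apply, inner_rsmul_rankOne S hS, smul_apply, _root_.inner_smul_right]

variable {T : E →ₗ[ℂ] F}

theorem vectorForm_map_eq_zero (hK : ∀ S : H →L[ℂ] H, IsCompactOperator S → S ∈ A)
    (hT : IsModuleLinear A T) (hO : IsOrthogonalityPreserving A T) {ζ : H} {u v : E}
    (h : vectorForm A ζ u v = 0) : vectorForm A ζ (T u) (T v) = 0 := by
  rcases eq_or_ne ζ 0 with rfl | hζ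
  · simp [vectorForm_apply]
  let S : A := ⟨_, hK _ (isCompactOperator_rankOne ζ ζ)⟩
  have h0 : inner A (u <• S) (v <• S) = 0 :=
    Subtype.ext (by rw [inner_rsmul_rankOne S rfl, h, zero_smul]; rfl)
  have h1 := congrArg (Subtype.val) (hO _ _ h0)
  rw [hT, hT, inner_rsmul_rankOne S rfl] at h1
  exact (smul_eq_zero_iff_left (rankOne_ne_zero hζ hζ)).1 h1

/-- Orthogonality preserving module maps multiply all inner squares by one and the same scalar. -/
theorem vectorForm_map_mul_vectorForm (hK : ∀ S : H →L[ℂ] H, IsCompactOperator S → S ∈ A)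
    (hT : IsModuleLinear A T) (hO : IsOrthogonalityPreserving A T) (ξ η : H) (x y : E) :
    vectorForm A ξ (T x) (T x) * vectorForm A η y y =
      vectorForm A ξ x x * vectorForm A η (T y) (T y) := by
  rcases eq_or_ne η 0 with rfl | hη
  · simp [vectorForm_apply]
  let R : A := ⟨_, hK _ (isCompactOperator_rankOne ξ η)⟩
  have key := hermitianForm_proportional (B := vectorForm A η)
    (C := fun u => vectorForm A η (T u) ∘ₗ T) (conj_vectorForm η)
    (fun u v => conj_vectorForm η (T u) (T v))
    (fun u v => vectorForm_map_eq_zero hK hT hO) (x <• R) y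
  have hne : inner ℂ η (rankOne ℂ η η η) ≠ 0 := by simp [hη]
  rw [LinearMap.comp_apply, LinearMap.comp_apply, hT,
    vectorForm_rsmul_rankOne R rfl, vectorForm_rsmul_rankOne R rfl] at key
  refine mul_right_cancel₀ hne ?_
  linear_combination key

theorem exists_inner_map_self_eq_smul (hK : ∀ S : H →L[ℂ] H, IsCompactOperator S → S ∈ A)
    (hT : IsModuleLinear A T) (hO : IsOrthogonalityPreserving A T) :
    ∃ c : ℂ, 0 ≤ c ∧ ∀ x : E, inner A (T x) (T x) = (c * c) • inner A x x := by
  have ext_form {a b : A}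
      (h : ∀ ξ, inner ℂ ξ ((a : H →L[ℂ] H) ξ) = inner ℂ ξ ((b : H →L[ℂ] H) ξ)) : a = b := by
    -- By complex polarization an operator is determined by its quadratic form.
    refine Subtype.ext (ContinuousLinearMap.coe_injective ((ext_inner_map _ _).1 fun ξ => ?_))
    have := congrArg conj (h ξ)
    rwa [inner_conj_symm, inner_conj_symm] at this
  by_cases h0 : ∀ (η : H) (y : E), vectorForm A η y y = 0
  · refine ⟨0, le_rfl, fun x => ext_form fun ξ => ?_⟩
    simpa [vectorForm_apply] using vectorForm_map_eq_zero hK hT hO (h0 ξ x)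
  · push Not at h0
    obtain ⟨η, y, hy⟩ := h0
    have hr : 0 ≤ (vectorForm A η (T y) (T y)).re / (vectorForm A η y y).re :=
      div_nonneg (Complex.nonneg_iff.1 (vectorForm_self_nonneg η (T y))).1
        (Complex.nonneg_iff.1 (vectorForm_self_nonneg η y)).1
    -- `c²` is the ratio of the two quadratic forms at one pair `(η, y)` where the denominator is
    -- nonzero.
    refine ⟨(√((vectorForm A η (T y) (T y)).re / (vectorForm A η y y).re) : ℝ),
      by exact_mod_cast Real.sqrt_nonneg _, fun x => ext_form fun ξ => ?_⟩
    rw [← Complex.ofReal_mul, Real.mul_self_sqrt hr, Complex.ofReal_div,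
      ← Complex.eq_re_of_ofReal_le (r := 0) (by simpa using vectorForm_self_nonneg η (T y)),
      ← Complex.eq_re_of_ofReal_le (r := 0) (by simpa using vectorForm_self_nonneg η y)]
    have := vectorForm_map_mul_vectorForm hK hT hO ξ η x y
    simp only [NonUnitalStarSubalgebra.coe_smul, smul_apply,
      _root_.inner_smul_right, ← vectorForm_apply]
    field_simp
    linear_combination this

end OperatorAlgebra

theorem mainTheorem2 {H : Type*} [NormedAddCommGroup H] [InnerProductSpace ℂ H] [CompleteSpace H]
    (A : NonUnitalStarSubalgebra ℂ (H →L[ℂ] H)) [hA : IsClosed (A : Set (H →L[ℂ] H))]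
    (hK : ∀ S : H →L[ℂ] H, IsCompactOperator S → S ∈ A)
    {E F : Type*}
    [AddCommGroup E] [Module ℂ E] [SMul (↥A)ᵐᵒᵖ E] [InnerProductCStarModule A E]
    [AddCommGroup F] [Module ℂ F] [SMul (↥A)ᵐᵒᵖ F] [InnerProductCStarModule A F]
    (T : E →ₗ[ℂ] F) (hT : InnerProductCStarModule.IsModuleLinear A T) (hT0 : T ≠ 0) :
    InnerProductCStarModule.IsOrthogonalityPreserving A T ↔
      ∀ x y : E,
        InnerProductCStarModule.modulus A x ≤ InnerProductCStarModule.modulus A y →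
          InnerProductCStarModule.modulus A (T x) ≤ InnerProductCStarModule.modulus A (T y) := by
  refine ⟨fun hO x y hxy => ?_,
    InnerProductCStarModule.isOrthogonalityPreserving_of_modulus_monotone⟩
  obtain ⟨c, hc, h⟩ := exists_inner_map_self_eq_smul hK hT hO
  exact InnerProductCStarModule.modulus_map_le_modulus_map hc h hxy
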